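/- Let $d\ge 1$ be an integer and $s\ge 1$ a real number; write $s=k+\gamma$ with $k\ge 0$ an integer and $\gamma\in(0,1]$. Let $\mathcal C^s_1$ be the set of $k$ times continuously differentiable functions $f:\mathbb{R}^d\to\mathbb{R}$ with $\|f\|_{\mathcal C^s}\le 1$, where $$\|f\|_{\mathcal C^s}=\max_{0\le j\le k}\ \max_{\omega\in\{1,\dots,d\}^j}\Big\|\frac{\partial^j f}{\partial x_{\omega_1}\cdots\partial x_{\omega_j}}\Big\|_\star$$ and $\|\cdot\|_\star$ is the uniform norm if $j<k$ and the $\gamma$-Hölder constant (with respect to the Euclidean distance) if $j=k$. For probability measures $\nu_0,\nu_1$ on $\mathbb{R}^d$ with bounded support, let $\|\nu_0-\nu_1\|_{\mathcal C^s_1}=\sup_{f\in\mathcal C^s_1}\big|\int f\,d\nu_0-\int f\,d\nu_1\big|$. There is a constant $C=C(d,s)>0$ such that, for every probability measure $\mu$ on $[0,1]^d$, every sequence $(X_k)_{k\ge 0}$ of independent identically distributed random variables of law $\mu$, and every integer $n\ge 2$, the empirical measure $\hat\mu_n=\frac1n\sum_{k=1}^n\delta_{X_k}$ satisfies $$\mathbb{E}\big[\|\hat\mu_n-\mu\|_{\mathcal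 C^s_1}\big]\le C\cdot\begin{cases}\dfrac{1}{\sqrt n} & \text{if } s>d/2,\\[2mm] \dfrac{\log n}{\sqrt n} & \text{if } s=d/2,\\[2mm] \dfrac{1}{n^{s/d}} & \text{if } s<d/2.\end{cases}$$ In particular $C$ does not depend on $\mu$. (The random variable $\|\hat\mu_n-\mu\|_{\mathcal C^s_1}$ is measurable.) -/

import Mathlib

open MeasureTheory ProbabilityTheory
open scoped ENNReal

noncomputable section

/-- The largest integer strictly below `s` (for `s > 0`): the `k` of the decomposition
`s = k + γ` with `γ ∈ (0, 1]`. -/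
def holderOrder (s : ℝ) : ℕ := ⌈s⌉₊ - 1

/-- The exponent `γ = s - k ∈ (0, 1]` of the decomposition `s = k + γ` (for `s > 0`). -/
def holderExponent (s : ℝ) : NNReal := Real.toNNReal (s - holderOrder s)

/-- The iterated partial derivative `∂^j f / ∂x_{ω 0} ⋯ ∂x_{ω (j - 1)}` (only used for functions
of class `C^j`): the `j`-th differential evaluated at vectors of the canonical basis. -/
def iteratedPartial {d j : ℕ} (f : EuclideanSpace ℝ (Fin d) → ℝ) (ω : Fin j → Fin d)
    (x : EuclideanSpace ℝ (Fin d)) : ℝ :=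
  iteratedFDeriv ℝ j f x (fun i => EuclideanSpace.single (ω i) (1 : ℝ))

/-- The (extended) `C^s` norm of a `k` times continuously differentiable function: the maximum, over
`j ≤ k` and all multi-indices of length `j`, of the uniform norm of the partial derivative
if `j < k`, and of its `γ`-Hölder constant (for the Euclidean distance) if `j = k`. -/
def csNorm {d : ℕ} (s : ℝ) (f : EuclideanSpace ℝ (Fin d) → ℝ) : ℝ≥0∞ :=
  ⨆ j ∈ Finset.range (holderOrder s + 1), ⨆ ω : Fin j → Fin d,
    if j < holderOrder s then ⨆ x, ‖iteratedPartial f ω x‖ₑ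
    else eHolderNorm (holderExponent s) (iteratedPartial f ω)

/-- The class `C^s_1` of functions on `ℝ^d` with `C^s` norm at most `1`. -/
def csUnitBall (d : ℕ) (s : ℝ) : Set (EuclideanSpace ℝ (Fin d) → ℝ) :=
  {f | ContDiff ℝ (holderOrder s : ℕ) f ∧ csNorm s f ≤ 1}

/-- `‖ν₀ - ν₁‖_F = sup_{f ∈ F} |ν₀(f) - ν₁(f)|`, with values in `[0, ∞]`. -/
def dualDist {E : Type*} [MeasurableSpace E] (F : Set (E → ℝ)) (ν₀ ν₁ : Measure E) : ℝ≥0∞ :=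
  ⨆ f ∈ F, ENNReal.ofReal |(∫ x, f x ∂ν₀) - ∫ x, f x ∂ν₁|

/-- The empirical measure `(1/n) ∑_{k=1}^n δ_{x_k}`. -/
def empiricalMeasure {E : Type*} [MeasurableSpace E] (x : ℕ → E) (n : ℕ) : Measure E :=
  (n : ℝ≥0∞)⁻¹ • ∑ k ∈ Finset.Icc 1 n, Measure.dirac (x k)

/-- The cube `[0,1]^d`. -/
def unitCube (d : ℕ) : Set (EuclideanSpace ℝ (Fin d)) :=
  {x | ∀ i, x i ∈ Set.Icc (0 : ℝ) 1}

/-- The rate of convergence. -/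
def rate (d : ℕ) (s : ℝ) (n : ℕ) : ℝ :=
  if (d : ℝ) / 2 < s then 1 / Real.sqrt n
  else if s = (d : ℝ) / 2 then Real.log n / Real.sqrt n
  else 1 / (n : ℝ) ^ (s / (d : ℝ))

end

/-!
A function of the `C^s` unit ball is approximated at scale `2⁻ʲ` by its Taylor polynomials at the
corners of the dyadic cells of the unit cube. The polynomials of two nested cells differ by
`O(2^{-sj})` on the smaller one, so up to an error `O(2^{-sJ})` the function is a combination of
rescaled monomials on the cells of scales `j ≤ J`, with coefficients `O(2^{-sj})` which do not
depend on the measures. For one such monomial, the expected discrepancy between the empirical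
measure and `μ` is at most `√(μ(cell) / n)`. By Cauchy–Schwarz, the sum over the about `2^{dj}`
cells of scale `j` is `O(2^{dj/2} / √n)`. The geometric sum of `2^{(d/2 - s)j} / √n` over `j ≤ J`
is then balanced against the truncation error `2^{-sJ}`.
-/

/-! ### Taylor approximation -/

section TaylorPolynomial

variable {E F : Type*} [NormedAddCommGroup E] [NormedSpace ℝ E]
  [NormedAddCommGroup F] [NormedSpace ℝ F]

theorem iteratedDeriv_comp_add_smul {f : E → F} {k m : ℕ} (hf : ContDiff ℝ k f) (hm : m ≤ k)
    (a v : E) (t : ℝ) :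
    iteratedDeriv m (fun r : ℝ => f (a + r • v)) t =
      iteratedFDeriv ℝ m f (a + t • v) (fun _ => v) := by
  induction m generalizing t with
  | zero => simp
  | succ m ih =>
    rw [iteratedDeriv_succ, funext (ih (by omega))]
    exact (hf.of_le (by exact_mod_cast hm)).contDiffAt.deriv_fderiv_add_smul

theorem exists_taylor_lagrange {f : E → ℝ} {k : ℕ} (hf : ContDiff ℝ k f) (a v : E) :
    ∃ t ∈ Set.Icc (0 : ℝ) 1, f (a + v) =
      ∑ m ∈ Finset.range k, (m.factorial : ℝ)⁻¹ * iteratedFDeriv ℝ m f a (fun _ => v) +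
        (k.factorial : ℝ)⁻¹ * iteratedFDeriv ℝ k f (a + t • v) (fun _ => v) := by
  cases k with
  | zero => exact ⟨1, by simp, by simp⟩
  | succ n =>
    have hg : ContDiff ℝ (n + 1 : ℕ) (fun r : ℝ => f (a + r • v)) := by fun_prop
    obtain ⟨t, ht, h⟩ := taylor_mean_remainder_lagrange_iteratedDeriv (n := n)
      (zero_ne_one (α := ℝ)) (by exact_mod_cast hg.contDiffOn (s := Set.uIcc 0 1))
    rw [Set.uIoo_of_le zero_le_one] at ht
    have hderiv : ∀ m ∈ Finset.range (n + 1),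
        iteratedDerivWithin m (fun r : ℝ => f (a + r • v)) (Set.uIcc 0 1) 0 =
          iteratedFDeriv ℝ m f a (fun _ => v) := by
      intro m hm
      have hm' : m ≤ n + 1 := (Finset.mem_range.1 hm).le
      rw [iteratedDerivWithin_eq_iteratedDeriv (uniqueDiffOn_uIcc zero_ne_one)
        (hg.of_le (by exact_mod_cast hm')).contDiffAt Set.left_mem_uIcc,
        iteratedDeriv_comp_add_smul hf hm', zero_smul, add_zero]
    rw [iteratedDeriv_comp_add_smul hf le_rfl, taylor_within_apply,
      Finset.sum_congr rfl fun m hm => by rw [hderiv m hm]] at h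
    simp only [one_smul, sub_zero, one_pow, mul_one, smul_eq_mul, sub_eq_iff_eq_add] at h
    exact ⟨t, Set.Ioo_subset_Icc_self ht, by rw [h]; ring⟩

variable {d k : ℕ} {f : EuclideanSpace ℝ (Fin d) → ℝ}

theorem iteratedFDeriv_apply_eq_sum_iteratedPartial (m : ℕ) (x v : EuclideanSpace ℝ (Fin d)) :
    iteratedFDeriv ℝ m f x (fun _ => v) =
      ∑ ω : Fin m → Fin d, (∏ i, v (ω i)) * iteratedPartial f ω x := by
  have hv : v = ∑ i, v i • EuclideanSpace.single i (1 : ℝ) := by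
    simpa using ((EuclideanSpace.basisFun (Fin d) ℝ).sum_repr v).symm
  conv_lhs => rw [hv]
  rw [ContinuousMultilinearMap.map_sum]
  exact Finset.sum_congr rfl fun ω _ => ContinuousMultilinearMap.map_smul_univ _ _ _

/-- The Taylor polynomial of order `k` of `f` at `a`, as a polynomial in the coordinates. -/
noncomputable def taylorMvPolynomial (k : ℕ) (f : EuclideanSpace ℝ (Fin d) → ℝ)
    (a : EuclideanSpace ℝ (Fin d)) : MvPolynomial (Fin d) ℝ :=
  ∑ m ∈ Finset.range (k + 1), ∑ ω : Fin m → Fin d,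
    MvPolynomial.C ((m.factorial : ℝ)⁻¹ * iteratedPartial f ω a) *
      ∏ i, (MvPolynomial.X (ω i) - MvPolynomial.C (a (ω i)))

theorem eval_taylorMvPolynomial (k : ℕ) (f : EuclideanSpace ℝ (Fin d) → ℝ)
    (a x : EuclideanSpace ℝ (Fin d)) :
    MvPolynomial.eval x.ofLp (taylorMvPolynomial k f a) =
      ∑ m ∈ Finset.range (k + 1),
        (m.factorial : ℝ)⁻¹ * iteratedFDeriv ℝ m f a (fun _ => x - a) := by
  simp only [taylorMvPolynomial, map_sum, map_mul, MvPolynomial.eval_C, map_prod, map_sub,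
    MvPolynomial.eval_X, iteratedFDeriv_apply_eq_sum_iteratedPartial, PiLp.sub_apply,
    Finset.mul_sum]
  refine Finset.sum_congr rfl fun m _ => Finset.sum_congr rfl fun ω _ => ?_
  ring

theorem totalDegree_taylorMvPolynomial_le (k : ℕ) (f : EuclideanSpace ℝ (Fin d) → ℝ)
    (a : EuclideanSpace ℝ (Fin d)) : (taylorMvPolynomial k f a).totalDegree ≤ k := by
  have hlinear (i : Fin d) :
      (MvPolynomial.X i - MvPolynomial.C (a i) : MvPolynomial (Fin d) ℝ).totalDegree ≤ 1 :=
    (MvPolynomial.totalDegree_sub_C_le _ _).trans_eq (MvPolynomial.totalDegree_X i)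
  refine MvPolynomial.totalDegree_finsetSum_le fun m hm =>
    MvPolynomial.totalDegree_finsetSum_le fun ω _ => ?_
  calc _ ≤ ∑ i : Fin m, 1 := by
        refine (MvPolynomial.totalDegree_mul _ _).trans ?_
        rw [MvPolynomial.totalDegree_C, zero_add]
        exact (MvPolynomial.totalDegree_finsetProd _ _).trans
          (Finset.sum_le_sum fun i _ => hlinear (ω i))
    _ ≤ k := by simpa using Nat.lt_succ_iff.1 (Finset.mem_range.1 hm)

theorem abs_iteratedFDeriv_sub_le {γ : NNReal}
    (hf : ∀ ω : Fin k → Fin d, HolderWith 1 γ (iteratedPartial f ω))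
    (x y v : EuclideanSpace ℝ (Fin d)) :
    |iteratedFDeriv ℝ k f x (fun _ => v) - iteratedFDeriv ℝ k f y (fun _ => v)| ≤
      (d : ℝ) ^ k * (‖v‖ ^ k * ‖x - y‖ ^ (γ : ℝ)) := by
  have hcoord (ω : Fin k → Fin d) : |∏ i, v (ω i)| ≤ ‖v‖ ^ k := by
    rw [Finset.abs_prod]
    simpa using Finset.prod_le_prod (s := Finset.univ) (fun _ _ => abs_nonneg _)
      fun i _ => PiLp.norm_apply_le v (ω i)
  have hholder (ω : Fin k → Fin d) :
      |iteratedPartial f ω x - iteratedPartial f ω y| ≤ ‖x - y‖ ^ (γ : ℝ) := by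
    simpa [Real.dist_eq, dist_eq_norm] using (hf ω).dist_le x y
  calc _ = |∑ ω : Fin k → Fin d,
        (∏ i, v (ω i)) * (iteratedPartial f ω x - iteratedPartial f ω y)| := by
        simp only [iteratedFDeriv_apply_eq_sum_iteratedPartial, mul_sub, Finset.sum_sub_distrib]
    _ ≤ ∑ ω : Fin k → Fin d, ‖v‖ ^ k * ‖x - y‖ ^ (γ : ℝ) := by
        refine (Finset.abs_sum_le_sum_abs _ _).trans (Finset.sum_le_sum fun ω _ => ?_)
        rw [abs_mul]
        exact mul_le_mul (hcoord ω) (hholder ω) (abs_nonneg _) (by positivity)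
    _ = _ := by simp

theorem abs_sub_taylorMvPolynomial_le {γ : NNReal} (hf : ContDiff ℝ k f)
    (hγ : ∀ ω : Fin k → Fin d, HolderWith 1 γ (iteratedPartial f ω))
    (a x : EuclideanSpace ℝ (Fin d)) :
    |f x - MvPolynomial.eval x.ofLp (taylorMvPolynomial k f a)| ≤
      (d : ℝ) ^ k * (‖x - a‖ ^ k * ‖x - a‖ ^ (γ : ℝ)) := by
  obtain ⟨t, ht, h⟩ := exists_taylor_lagrange hf a (x - a)
  have hfactorial : |(k.factorial : ℝ)⁻¹| ≤ 1 := by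
    rw [abs_of_nonneg (by positivity)]
    exact inv_le_one_of_one_le₀ (by exact_mod_cast Nat.succ_le_of_lt k.factorial_pos)
  have hsegment : ‖a + t • (x - a) - a‖ ≤ ‖x - a‖ := by
    rw [add_sub_cancel_left, norm_smul, Real.norm_of_nonneg ht.1]
    exact mul_le_of_le_one_left (norm_nonneg _) ht.2
  rw [add_sub_cancel] at h
  rw [eval_taylorMvPolynomial, h, Finset.sum_range_succ, add_sub_add_left_eq_sub, ← mul_sub,
    abs_mul]
  refine (mul_le_of_le_one_left (abs_nonneg _) hfactorial).trans
    ((abs_iteratedFDeriv_sub_le hγ _ _ _).trans ?_)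
  gcongr

end TaylorPolynomial

section PolynomialApprox

variable {d k : ℕ} {s A : ℝ} {f g : EuclideanSpace ℝ (Fin d) → ℝ}
  {p : EuclideanSpace ℝ (Fin d) → MvPolynomial (Fin d) ℝ}

/-- The polynomials `p a`, of degree at most `k`, approximate `g` to order `s` around each point
`a`, with constant `A`. This is the only consequence of `C^s` regularity used in the multiscale
decomposition. -/
structure IsPolynomialApprox (k : ℕ) (s A : ℝ) (g : EuclideanSpace ℝ (Fin d) → ℝ)
    (p : EuclideanSpace ℝ (Fin d) → MvPolynomial (Fin d) ℝ) : Prop where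
  nonneg : 0 ≤ A
  totalDegree_le : ∀ a, (p a).totalDegree ≤ k
  abs_sub_le : ∀ a x, |g x - MvPolynomial.eval x.ofLp (p a)| ≤ A * ‖x - a‖ ^ s

theorem IsPolynomialApprox.sub_const (h : IsPolynomialApprox k s A g p) (c : ℝ) :
    IsPolynomialApprox k s A (fun x => g x - c) (fun a => p a - MvPolynomial.C c) where
  nonneg := h.nonneg
  totalDegree_le a := (MvPolynomial.totalDegree_sub_C_le _ _).trans (h.totalDegree_le a)
  abs_sub_le a x := by simpa using h.abs_sub_le a x

theorem IsPolynomialApprox.abs_sub_le_of_degree_zero (h : IsPolynomialApprox 0 s A g p)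
    (hs : 0 < s) (x y : EuclideanSpace ℝ (Fin d)) : |g x - g y| ≤ A * ‖x - y‖ ^ s := by
  have hp := MvPolynomial.totalDegree_eq_zero_iff_eq_C.1 (Nat.le_zero.1 (h.totalDegree_le y))
  have hx := h.abs_sub_le y x
  have hy := h.abs_sub_le y y
  rw [hp, MvPolynomial.eval_C] at hx hy
  rw [sub_self, norm_zero, Real.zero_rpow hs.ne', mul_zero, abs_nonpos_iff, sub_eq_zero] at hy
  rwa [hy]

theorem holderOrder_add_holderExponent (hs : 0 < s) :
    (holderOrder s : ℝ) + holderExponent s = s := by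
  have hle : (holderOrder s : ℝ) ≤ s := by
    rw [holderOrder, Nat.cast_sub (Nat.one_le_ceil_iff.2 hs), Nat.cast_one]
    linarith [Nat.ceil_lt_add_one hs.le]
  rw [holderExponent, Real.coe_toNNReal _ (sub_nonneg.2 hle), add_sub_cancel]

theorem holderWith_of_csNorm_le_one (hf : csNorm s f ≤ 1) (ω : Fin (holderOrder s) → Fin d) :
    HolderWith 1 (holderExponent s) (iteratedPartial f ω) := by
  have h : eHolderNorm (holderExponent s) (iteratedPartial f ω) ≤ 1 := by
    have h := iSup_le_iff.1 (iSup₂_le_iff.1 hf _ (Finset.self_mem_range_succ _)) ω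
    rwa [if_neg (lt_irrefl _)] at h
  have hm : MemHolder (holderExponent s) (iteratedPartial f ω) :=
    eHolderNorm_ne_top.1 (ne_top_of_le_ne_top ENNReal.one_ne_top h)
  rw [← hm.coe_nnHolderNorm_eq_eHolderNorm] at h
  exact hm.holderWith.mono (by exact_mod_cast h)

theorem abs_le_one_of_csNorm_le_one (hf : csNorm s f ≤ 1) (hs : 0 < holderOrder s)
    (x : EuclideanSpace ℝ (Fin d)) : |f x| ≤ 1 := by
  have h := iSup_le_iff.1 (iSup₂_le_iff.1 hf 0 (Finset.mem_range.2 (Nat.succ_pos _))) Fin.elim0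
  rw [if_pos hs] at h
  have hx : ‖f x‖ₑ ≤ 1 := by simpa [iteratedPartial] using iSup_le_iff.1 h x
  simpa [← ofReal_norm] using hx

theorem isPolynomialApprox_taylorMvPolynomial (hs : 0 < s) (hf : f ∈ csUnitBall d s) :
    IsPolynomialApprox (holderOrder s) s ((d : ℝ) ^ holderOrder s) f
      (taylorMvPolynomial (holderOrder s) f) where
  nonneg := by positivity
  totalDegree_le := totalDegree_taylorMvPolynomial_le _ f
  abs_sub_le a x := by
    have h := abs_sub_taylorMvPolynomial_le hf.1 (holderWith_of_csNorm_le_one hf.2) a x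
    rwa [← Real.rpow_natCast ‖x - a‖, ← Real.rpow_add_of_nonneg (norm_nonneg _)
      (Nat.cast_nonneg _) (NNReal.coe_nonneg _), holderOrder_add_holderExponent hs] at h

theorem abs_sub_le_of_mem_csUnitBall (hs : 0 < s) (hf : f ∈ csUnitBall d s)
    (x y : EuclideanSpace ℝ (Fin d)) : |f x - f y| ≤ 2 + ‖x - y‖ ^ s := by
  have h0 : 0 ≤ ‖x - y‖ ^ s := by positivity
  rcases Nat.eq_zero_or_pos (holderOrder s) with hk | hk
  · have happrox := isPolynomialApprox_taylorMvPolynomial hs hf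
    rw [hk, pow_zero] at happrox
    linarith [happrox.abs_sub_le_of_degree_zero hs x y]
  · linarith [abs_sub (f x) (f y), abs_le_one_of_csNorm_le_one hf.2 hk x,
      abs_le_one_of_csNorm_le_one hf.2 hk y]

end PolynomialApprox

/-! ### Coefficients of polynomials of bounded degree -/

section PolynomialCoefficients

theorem exists_abs_le_mul_of_iInf_ker_le_ker {ι V : Type*} [AddCommGroup V] [Module ℝ V]
    [FiniteDimensional ℝ V] {L : ι → V →ₗ[ℝ] ℝ} {φ : V →ₗ[ℝ] ℝ}
    (h : ⨅ i, LinearMap.ker (L i) ≤ LinearMap.ker φ) :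
    ∃ K : ℝ, 0 ≤ K ∧ ∀ v M, (∀ i, |L i v| ≤ M) → |φ v| ≤ K * M := by
  obtain ⟨c, rfl⟩ := Finsupp.mem_span_range_iff_exists_finsupp.1
    (FiniteDimensional.mem_span_of_iInf_ker_le_ker h)
  refine ⟨∑ i ∈ c.support, |c i|, by positivity, fun v M hM => ?_⟩
  simp only [Finsupp.sum, LinearMap.sum_apply, LinearMap.smul_apply, smul_eq_mul, Finset.sum_mul]
  refine (Finset.abs_sum_le_sum_abs _ _).trans (Finset.sum_le_sum fun i _ => ?_)
  rw [abs_mul]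
  exact mul_le_mul_of_nonneg_left (hM i) (abs_nonneg _)

variable {d k : ℕ}

/-- The multi-indices with all entries at most `k`. They include the support of every polynomial of
total degree at most `k`, and form a product set. -/
noncomputable def exponents (d k : ℕ) : Finset (Fin d →₀ ℕ) :=
  Finset.Iic (Finsupp.equivFunOnFinite.symm fun _ => k)

theorem support_subset_exponents {p : MvPolynomial (Fin d) ℝ} (hp : p.totalDegree ≤ k) :
    p.support ⊆ exponents d k := fun _ hα => Finset.mem_Iic.2 fun i =>
  ((MvPolynomial.monomial_le_degreeOf i hα).trans (p.degreeOf_le_totalDegree i)).trans hp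

theorem eval_eq_sum_exponents {p : MvPolynomial (Fin d) ℝ} (hp : p.totalDegree ≤ k)
    (u : Fin d → ℝ) :
    MvPolynomial.eval u p = ∑ α ∈ exponents d k, p.coeff α * ∏ i, u i ^ α i := by
  rw [MvPolynomial.eval_eq']
  exact Finset.sum_subset (support_subset_exponents hp) fun α _ hα => by
    rw [MvPolynomial.notMem_support_iff.1 hα, zero_mul]

theorem exists_abs_coeff_le_of_abs_eval_le (k : ℕ) {S : Fin d → Set ℝ}
    (hS : ∀ i, (S i).Infinite) : ∃ K : ℝ, 0 ≤ K ∧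
      ∀ p : MvPolynomial (Fin d) ℝ, p.totalDegree ≤ k → ∀ M : ℝ,
        (∀ u ∈ Set.univ.pi S, |MvPolynomial.eval u p| ≤ M) →
        ∀ α ∈ exponents d k, |p.coeff α| ≤ K * M := by
  let V := MvPolynomial.restrictTotalDegree (Fin d) ℝ k
  let evalAt (u : Set.univ.pi S) : V →ₗ[ℝ] ℝ := (MvPolynomial.aeval u.1).toLinearMap ∘ₗ V.subtype
  have hker (α : Fin d →₀ ℕ) : ⨅ u, LinearMap.ker (evalAt u) ≤
      LinearMap.ker (MvPolynomial.lcoeff ℝ α ∘ₗ V.subtype) := by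
    intro p hp
    have hp0 : (p : MvPolynomial (Fin d) ℝ) = 0 := MvPolynomial.funext_set S hS fun u hu => by
      simpa [evalAt, MvPolynomial.aeval_eq_eval] using (Submodule.mem_iInf _).1 hp ⟨u, hu⟩
    simp [hp0]
  choose K hK0 hK using fun α => exists_abs_le_mul_of_iInf_ker_le_ker (hker α)
  refine ⟨∑ α ∈ exponents d k, K α, Finset.sum_nonneg fun α _ => hK0 α, fun p hp M hM α hα => ?_⟩
  have hM0 : 0 ≤ M := by
    obtain ⟨u, hu⟩ := Set.univ_pi_nonempty_iff.2 fun i => (hS i).nonempty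
    exact (abs_nonneg _).trans (hM u hu)
  calc |p.coeff α| ≤ K α * M := hK α ⟨p, (MvPolynomial.mem_restrictTotalDegree _ _ _).2 hp⟩ M
        fun u => by simpa [evalAt, MvPolynomial.aeval_eq_eval] using hM u u.2
    _ ≤ _ := mul_le_mul_of_nonneg_right (Finset.single_le_sum (fun α _ => hK0 α) hα) hM0

theorem totalDegree_bind₁_le {R σ τ : Type*} [CommSemiring R] {f : σ → MvPolynomial τ R}
    (hf : ∀ i, (f i).totalDegree ≤ 1) (p : MvPolynomial σ R) :
    (MvPolynomial.bind₁ f p).totalDegree ≤ p.totalDegree := by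
  rw [← MvPolynomial.aeval_eq_bind₁, MvPolynomial.aeval_def, MvPolynomial.eval₂_eq]
  refine MvPolynomial.totalDegree_finsetSum_le fun α hα => ?_
  calc _ ≤ ∑ i ∈ α.support, α i := by
        refine (MvPolynomial.totalDegree_mul _ _).trans ?_
        rw [MvPolynomial.algebraMap_eq, MvPolynomial.totalDegree_C, zero_add]
        refine (MvPolynomial.totalDegree_finsetProd _ _).trans (Finset.sum_le_sum fun i _ => ?_)
        exact (MvPolynomial.totalDegree_pow _ _).trans
            (mul_le_of_le_one_right (Nat.zero_le _) (hf i))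
    _ ≤ p.totalDegree := MvPolynomial.le_totalDegree hα

end PolynomialCoefficients

/-! ### Dyadic cells -/

section DyadicCells

variable {d : ℕ} {x : EuclideanSpace ℝ (Fin d)}

/-- The multi-index of the dyadic cell of side `2⁻ʲ` containing a point of the positive orthant. -/
noncomputable def dyadicIndex (j : ℕ) (x : EuclideanSpace ℝ (Fin d)) : Fin d → ℕ :=
  fun i => ⌊(2 : ℝ) ^ j * x i⌋₊

/-- The indices of the half-open dyadic cells of side `2⁻ʲ` meeting the closed unit cube: the value
`2 ^ j` occurs on its upper faces. -/
def dyadicIndices (d j : ℕ) : Finset (Fin d → ℕ) :=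
  Fintype.piFinset fun _ => Finset.range (2 ^ j + 1)

/-- The part of a dyadic cell inside the unit cube. -/
def dyadicCell (j : ℕ) (z : Fin d → ℕ) : Set (EuclideanSpace ℝ (Fin d)) :=
  {x | x ∈ unitCube d ∧ dyadicIndex j x = z}

/-- A monomial in the coordinates of a dyadic cell rescaled to the unit cube, extended by zero. -/
noncomputable def cellMonomial (j : ℕ) (z : Fin d → ℕ) (α : Fin d →₀ ℕ) :
    EuclideanSpace ℝ (Fin d) → ℝ :=
  (dyadicCell j z).indicator fun x => ∏ i, ((2 : ℝ) ^ j * x i - z i) ^ α i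

/-- The point with coordinates `y` in the units of the dyadic grid of side `2⁻ʲ`. -/
noncomputable def dyadicPoint (j : ℕ) (y : Fin d → ℝ) : EuclideanSpace ℝ (Fin d) :=
  WithLp.toLp 2 fun i => (1 / 2) ^ j * y i

theorem dyadicIndex_mem_dyadicIndices (hx : x ∈ unitCube d) (j : ℕ) :
    dyadicIndex j x ∈ dyadicIndices d j := by
  refine Fintype.mem_piFinset.2 fun i => Finset.mem_range_succ_iff.2 (Nat.floor_le_of_le ?_)
  push_cast
  exact mul_le_of_le_one_right (by positivity) (hx i).2

theorem card_dyadicIndices (d j : ℕ) : (dyadicIndices d j).card = (2 ^ j + 1) ^ d := by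
  simp [dyadicIndices]

theorem dyadicIndex_succ_div_two (j : ℕ) (x : EuclideanSpace ℝ (Fin d)) (i : Fin d) :
    dyadicIndex (j + 1) x i / 2 = dyadicIndex j x i := by
  rw [dyadicIndex, dyadicIndex, ← Nat.floor_div_ofNat]
  congr 1
  ring

theorem sub_dyadicIndex_mem_Icc (hx : x ∈ unitCube d) (j : ℕ) (i : Fin d) :
    (2 : ℝ) ^ j * x i - dyadicIndex j x i ∈ Set.Icc (0 : ℝ) 1 := by
  have h0 : 0 ≤ (2 : ℝ) ^ j * x i := mul_nonneg (by positivity) (hx i).1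
  exact ⟨sub_nonneg.2 (Nat.floor_le h0), sub_le_iff_le_add'.2 (Nat.lt_floor_add_one _).le⟩

theorem abs_cellMonomial_le (j : ℕ) (z : Fin d → ℕ) (α : Fin d →₀ ℕ)
    (x : EuclideanSpace ℝ (Fin d)) :
    |cellMonomial j z α x| ≤ (dyadicCell j z).indicator (fun _ => 1) x := by
  by_cases hx : x ∈ dyadicCell j z
  · rw [cellMonomial, Set.indicator_of_mem hx, Set.indicator_of_mem hx, Finset.abs_prod]
    refine Finset.prod_le_one (fun _ _ => abs_nonneg _) fun i _ => ?_
    have hi := sub_dyadicIndex_mem_Icc hx.1 j i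
    rw [hx.2] at hi
    rw [abs_pow, abs_of_nonneg hi.1]
    exact pow_le_one₀ hi.1 hi.2
  · rw [cellMonomial, Set.indicator_of_notMem hx, Set.indicator_of_notMem hx, abs_zero]

theorem sum_mul_cellMonomial (hx : x ∈ unitCube d) (j : ℕ) (S : Finset (Fin d →₀ ℕ))
    (c : (Fin d → ℕ) → (Fin d →₀ ℕ) → ℝ) :
    ∑ z ∈ dyadicIndices d j, ∑ α ∈ S, c z α * cellMonomial j z α x =
      ∑ α ∈ S, c (dyadicIndex j x) α * ∏ i, ((2 : ℝ) ^ j * x i - dyadicIndex j x i) ^ α i := by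
  rw [Finset.sum_eq_single_of_mem _ (dyadicIndex_mem_dyadicIndices hx j)]
  · have hmem : x ∈ dyadicCell j (dyadicIndex j x) := ⟨hx, rfl⟩
    simp only [cellMonomial, Set.indicator_of_mem hmem]
  · intro z _ hz
    have hnotMem : x ∉ dyadicCell j z := fun h => hz h.2.symm
    simp only [cellMonomial, Set.indicator_of_notMem hnotMem, mul_zero, Finset.sum_const_zero]

theorem dyadicPoint_two_pow_mul (j : ℕ) (x : EuclideanSpace ℝ (Fin d)) :
    dyadicPoint j (fun i => 2 ^ j * x i) = x := by
  ext i
  simp [dyadicPoint]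

theorem dyadicPoint_succ (j : ℕ) (y : Fin d → ℝ) :
    dyadicPoint (j + 1) y = dyadicPoint j fun i => y i / 2 := by
  ext i
  simp only [dyadicPoint, pow_succ]
  ring

theorem norm_le_mul_sqrt_of_abs_le {r : ℝ} (hr : 0 ≤ r) (h : ∀ i, |x i| ≤ r) : ‖x‖ ≤ r * √d := by
  rw [EuclideanSpace.norm_eq]
  refine Real.sqrt_le_iff.2 ⟨by positivity, ?_⟩
  rw [mul_pow, Real.sq_sqrt (Nat.cast_nonneg d), mul_comm]
  simpa using Finset.sum_le_card_nsmul Finset.univ (fun i => ‖x i‖ ^ 2) (r ^ 2)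
    fun i _ => pow_le_pow_left₀ (norm_nonneg _) (h i) 2

theorem norm_dyadicPoint_sub_le (j : ℕ) {y y' : Fin d → ℝ} (h : ∀ i, |y i - y' i| ≤ 1) :
    ‖dyadicPoint j y - dyadicPoint j y'‖ ≤ (1 / 2) ^ j * √d := by
  refine norm_le_mul_sqrt_of_abs_le (by positivity) fun i => ?_
  have hi : (dyadicPoint j y - dyadicPoint j y') i = (1 / 2) ^ j * (y i - y' i) :=
    (mul_sub _ _ _).symm
  rw [hi, abs_mul, abs_of_nonneg (by positivity)]
  exact mul_le_of_le_one_right (by positivity) (h i)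

end DyadicCells

/-! ### Multiscale decomposition -/

section Multiscale

variable {d k : ℕ} {s A B : ℝ} {g : EuclideanSpace ℝ (Fin d) → ℝ}
  {p : EuclideanSpace ℝ (Fin d) → MvPolynomial (Fin d) ℝ}

/-- The polynomial to add on the cell `z` of side `2⁻ʲ` when the local approximation at the corner
of its parent cell is replaced by the one at its own corner. -/
noncomputable def dyadicIncrement (p : EuclideanSpace ℝ (Fin d) → MvPolynomial (Fin d) ℝ) :
    ℕ → (Fin d → ℕ) → MvPolynomial (Fin d) ℝ
  | 0, z => p (dyadicPoint 0 fun i => z i)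
  | j + 1, z => p (dyadicPoint (j + 1) fun i => z i) - p (dyadicPoint j fun i => (z i / 2 : ℕ))

/-- The increment `dyadicIncrement p j z` in the coordinates of the cell rescaled to the unit
cube. -/
noncomputable def cellPolynomial (p : EuclideanSpace ℝ (Fin d) → MvPolynomial (Fin d) ℝ) (j : ℕ)
    (z : Fin d → ℕ) : MvPolynomial (Fin d) ℝ :=
  MvPolynomial.bind₁ (fun i => MvPolynomial.C ((1 / 2) ^ j) *
    (MvPolynomial.C (z i : ℝ) + MvPolynomial.X i)) (dyadicIncrement p j z)

/-- The multiscale approximation, up to scale `2⁻ᴶ`, of a function on the unit cube with local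
polynomial approximations `p` of degree at most `k`. -/
noncomputable def multiscaleApprox (k : ℕ)
    (p : EuclideanSpace ℝ (Fin d) → MvPolynomial (Fin d) ℝ) (J : ℕ)
    (x : EuclideanSpace ℝ (Fin d)) : ℝ :=
  ∑ j ∈ Finset.range (J + 1), ∑ z ∈ dyadicIndices d j, ∑ α ∈ exponents d k,
    (cellPolynomial p j z).coeff α * cellMonomial j z α x

theorem eval_cellPolynomial (j : ℕ) (z : Fin d → ℕ) (u : Fin d → ℝ) :
    MvPolynomial.eval u (cellPolynomial p j z) =
      MvPolynomial.eval (dyadicPoint j fun i => z i + u i).ofLp (dyadicIncrement p j z) := by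
  rw [cellPolynomial, ← MvPolynomial.coe_aeval_eq_eval, RingHom.coe_coe,
    MvPolynomial.aeval_bind₁, ← MvPolynomial.coe_aeval_eq_eval, RingHom.coe_coe]
  simp [dyadicPoint]

theorem totalDegree_cellPolynomial_le (hp : ∀ a, (p a).totalDegree ≤ k) (j : ℕ)
    (z : Fin d → ℕ) : (cellPolynomial p j z).totalDegree ≤ k := by
  have hincrement : (dyadicIncrement p j z).totalDegree ≤ k := by
    cases j with
    | zero => exact hp _
    | succ j => exact (MvPolynomial.totalDegree_sub _ _).trans (max_le (hp _) (hp _))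
  refine (totalDegree_bind₁_le (fun i => ?_) _).trans hincrement
  refine (MvPolynomial.totalDegree_mul _ _).trans ?_
  rw [MvPolynomial.totalDegree_C, zero_add]
  exact (MvPolynomial.totalDegree_add _ _).trans <| max_le
    ((MvPolynomial.totalDegree_C _).trans_le zero_le_one) (MvPolynomial.totalDegree_X i).le

theorem sum_dyadicIncrement (J : ℕ) (x : EuclideanSpace ℝ (Fin d)) :
    ∑ j ∈ Finset.range (J + 1), dyadicIncrement p j (dyadicIndex j x) =
      p (dyadicPoint J fun i => dyadicIndex J x i) := by
  induction J with
  | zero => simp [dyadicIncrement]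
  | succ J ih =>
    rw [Finset.sum_range_succ, ih]
    simp only [dyadicIncrement, dyadicIndex_succ_div_two, add_sub_cancel]

theorem multiscaleApprox_eq_eval (hp : ∀ a, (p a).totalDegree ≤ k) (J : ℕ)
    {x : EuclideanSpace ℝ (Fin d)} (hx : x ∈ unitCube d) :
    multiscaleApprox k p J x =
      MvPolynomial.eval x.ofLp (p (dyadicPoint J fun i => dyadicIndex J x i)) := by
  rw [multiscaleApprox, ← sum_dyadicIncrement (p := p) J x, map_sum]
  refine Finset.sum_congr rfl fun j _ => ?_
  rw [sum_mul_cellMonomial hx j _ fun z α => (cellPolynomial p j z).coeff α,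
    ← eval_eq_sum_exponents (totalDegree_cellPolynomial_le hp _ _), eval_cellPolynomial]
  simp only [add_sub_cancel, dyadicPoint_two_pow_mul]

namespace IsPolynomialApprox

theorem abs_sub_dyadicPoint_le (h : IsPolynomialApprox k s A g p) (hs : 0 ≤ s) (j : ℕ)
    {y y' : Fin d → ℝ} (hy : ∀ i, |y i - y' i| ≤ 1) :
    |g (dyadicPoint j y) - MvPolynomial.eval (dyadicPoint j y).ofLp (p (dyadicPoint j y'))| ≤
      A * √d ^ s * (2 ^ (-s)) ^ j := by
  have hscale : ((1 / 2 : ℝ) ^ j) ^ s = (2 ^ (-s)) ^ j := by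
    rw [← Real.rpow_natCast, ← Real.rpow_natCast, ← Real.rpow_mul (by norm_num), mul_comm,
      Real.rpow_mul (by norm_num), one_div, Real.inv_rpow zero_le_two, Real.rpow_neg zero_le_two]
  have hA := h.nonneg
  calc _ ≤ A * ‖dyadicPoint j y - dyadicPoint j y'‖ ^ s := h.abs_sub_le _ _
    _ ≤ A * ((1 / 2) ^ j * √d) ^ s := by
        gcongr
        exact norm_dyadicPoint_sub_le j hy
    _ = A * √d ^ s * (2 ^ (-s)) ^ j := by
        rw [Real.mul_rpow (by positivity) (by positivity), hscale]
        ring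

theorem abs_sub_multiscaleApprox_le (h : IsPolynomialApprox k s A g p) (hs : 0 ≤ s) (J : ℕ)
    {x : EuclideanSpace ℝ (Fin d)} (hx : x ∈ unitCube d) :
    |g x - multiscaleApprox k p J x| ≤ A * √d ^ s * (2 ^ (-s)) ^ J := by
  have hcorner := h.abs_sub_dyadicPoint_le hs J (y := fun i => 2 ^ J * x i)
    (y' := fun i => dyadicIndex J x i) fun i => by
      have hi := sub_dyadicIndex_mem_Icc hx J i
      rw [abs_of_nonneg hi.1]
      exact hi.2
  rwa [dyadicPoint_two_pow_mul, ← multiscaleApprox_eq_eval h.totalDegree_le J hx] at hcorner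

theorem abs_eval_dyadicIncrement_zero_le (h : IsPolynomialApprox k s A g p) (hs : 0 ≤ s)
    (hB : ∀ x, (∀ i, x i ∈ Set.Icc (0 : ℝ) 2) → |g x| ≤ B) {z : Fin d → ℕ}
    (hz : z ∈ dyadicIndices d 0) {u : Fin d → ℝ} (hu : ∀ i, u i ∈ Set.Icc (0 : ℝ) 1) :
    |MvPolynomial.eval (dyadicPoint 0 fun i => z i + u i).ofLp (dyadicIncrement p 0 z)| ≤
      B + A * √d ^ s := by
  have hclose := h.abs_sub_dyadicPoint_le hs 0 (y := fun i => z i + u i) (y' := fun i => z i)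
    fun i => by simpa [abs_of_nonneg (hu i).1] using (hu i).2
  have hg : |g (dyadicPoint 0 fun i => z i + u i)| ≤ B := hB _ fun i => by
    have hzi : (z i : ℝ) ≤ 1 := by
      exact_mod_cast Finset.mem_range_succ_iff.1 (Fintype.mem_piFinset.1 hz i)
    have hzi0 : (0 : ℝ) ≤ z i := Nat.cast_nonneg _
    simp only [dyadicPoint, pow_zero, one_mul, Set.mem_Icc]
    constructor <;> linarith [(hu i).1, (hu i).2]
  rw [pow_zero, mul_one] at hclose
  rw [dyadicIncrement, ← sub_sub_cancel (g (dyadicPoint 0 fun i => z i + u i))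
    (MvPolynomial.eval _ _)]
  exact (abs_sub _ _).trans (add_le_add hg hclose)

theorem abs_eval_dyadicIncrement_succ_le (h : IsPolynomialApprox k s A g p) (hs : 0 ≤ s) (j : ℕ)
    (z : Fin d → ℕ) {u : Fin d → ℝ} (hu : ∀ i, u i ∈ Set.Icc (0 : ℝ) 1) :
    |MvPolynomial.eval (dyadicPoint (j + 1) fun i => z i + u i).ofLp
        (dyadicIncrement p (j + 1) z)| ≤
      A * √d ^ s * (1 + 2 ^ s) * (2 ^ (-s)) ^ (j + 1) := by
  have hchild := h.abs_sub_dyadicPoint_le hs (j + 1) (y := fun i => z i + u i)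
    (y' := fun i => z i) fun i => by simpa [abs_of_nonneg (hu i).1] using (hu i).2
  have hparent := h.abs_sub_dyadicPoint_le hs j (y := fun i => (z i + u i) / 2)
    (y' := fun i => (z i / 2 : ℕ)) fun i => by
      have hlow : (2 * (z i / 2 : ℕ) : ℝ) ≤ z i := by exact_mod_cast Nat.mul_div_le _ _
      have hupp : (z i : ℝ) ≤ 2 * (z i / 2 : ℕ) + 1 := by
        exact_mod_cast (by omega : z i ≤ 2 * (z i / 2) + 1)
      rw [abs_le]
      constructor <;> linarith [(hu i).1, (hu i).2]
  have hscale : (2 ^ (-s)) ^ j = 2 ^ s * (2 ^ (-s) : ℝ) ^ (j + 1) := by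
    rw [pow_succ', ← mul_assoc, ← Real.rpow_add two_pos, add_neg_cancel, Real.rpow_zero, one_mul]
  rw [← dyadicPoint_succ, hscale] at hparent
  rw [dyadicIncrement, map_sub]
  refine (_root_.abs_sub_le _ (g (dyadicPoint (j + 1) fun i => z i + u i)) _).trans ?_
  rw [abs_sub_comm _ (g _)]
  linarith

theorem abs_eval_cellPolynomial_le (h : IsPolynomialApprox k s A g p) (hs : 0 ≤ s)
    (hB : ∀ x, (∀ i, x i ∈ Set.Icc (0 : ℝ) 2) → |g x| ≤ B) {j : ℕ} {z : Fin d → ℕ}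
    (hz : z ∈ dyadicIndices d j) {u : Fin d → ℝ} (hu : ∀ i, u i ∈ Set.Icc (0 : ℝ) 1) :
    |MvPolynomial.eval u (cellPolynomial p j z)| ≤
      (B + A * √d ^ s * (1 + 2 ^ s)) * (2 ^ (-s)) ^ j := by
  have hB0 : 0 ≤ B := (abs_nonneg _).trans (hB 0 fun _ => by simp)
  have hA : 0 ≤ A * √d ^ s := mul_nonneg h.nonneg (by positivity)
  have h2 : (0 : ℝ) ≤ 2 ^ s := by positivity
  rw [eval_cellPolynomial]
  cases j with
  | zero =>
    rw [pow_zero, mul_one]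
    nlinarith [h.abs_eval_dyadicIncrement_zero_le hs hB hz hu]
  | succ j =>
    refine (h.abs_eval_dyadicIncrement_succ_le hs j z hu).trans ?_
    gcongr
    exact le_add_of_nonneg_left hB0

end IsPolynomialApprox

theorem exists_abs_coeff_cellPolynomial_le (d k : ℕ) : ∃ K : ℝ, 0 ≤ K ∧
    ∀ {s A B : ℝ} {g : EuclideanSpace ℝ (Fin d) → ℝ}
      {p : EuclideanSpace ℝ (Fin d) → MvPolynomial (Fin d) ℝ},
      IsPolynomialApprox k s A g p → 0 ≤ s →
      (∀ x, (∀ i, x i ∈ Set.Icc (0 : ℝ) 2) → |g x| ≤ B) →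
      ∀ j, ∀ z ∈ dyadicIndices d j, ∀ α ∈ exponents d k,
        |(cellPolynomial p j z).coeff α| ≤
          K * (B + A * √d ^ s * (1 + 2 ^ s)) * (2 ^ (-s)) ^ j := by
  obtain ⟨K, hK0, hK⟩ := exists_abs_coeff_le_of_abs_eval_le k
    (S := fun _ : Fin d => Set.Icc 0 1) fun _ => Set.Icc_infinite zero_lt_one
  refine ⟨K, hK0, fun h hs hB j z hz α hα => ?_⟩
  rw [mul_assoc]
  exact hK _ (totalDegree_cellPolynomial_le h.totalDegree_le j z) _
    (fun u hu => h.abs_eval_cellPolynomial_le hs hB hz fun i => hu i trivial) α hα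

end Multiscale

/-! ### The dual distance on the unit cube -/

section DualDistance

variable {d k : ℕ} {s A K : ℝ} {g : EuclideanSpace ℝ (Fin d) → ℝ}
  {p : EuclideanSpace ℝ (Fin d) → MvPolynomial (Fin d) ℝ}
  {ν ν₀ ν₁ : Measure (EuclideanSpace ℝ (Fin d))}

theorem isCompact_unitCube (d : ℕ) : IsCompact (unitCube d) := by
  have hpi : unitCube d = EuclideanSpace.equiv (Fin d) ℝ ⁻¹' Set.univ.pi fun _ => Set.Icc 0 1 :=
    Set.ext fun _ => Set.mem_univ_pi.symm
  rw [hpi]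
  exact (EuclideanSpace.equiv (Fin d) ℝ).toHomeomorph.isCompact_preimage.2
    (isCompact_univ_pi fun _ => isCompact_Icc)

theorem integrable_of_continuous_of_ae_mem_unitCube [IsFiniteMeasure ν] (hg : Continuous g)
    (hν : ∀ᵐ x ∂ν, x ∈ unitCube d) : Integrable g ν := by
  have h := hg.continuousOn.integrableOn_compact (isCompact_unitCube d) (μ := ν)
  rwa [IntegrableOn, Measure.restrict_eq_self_of_ae_mem hν] at h

theorem measurableSet_dyadicCell (j : ℕ) (z : Fin d → ℕ) : MeasurableSet (dyadicCell j z) := by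
  have hindex : Measurable (dyadicIndex j : EuclideanSpace ℝ (Fin d) → Fin d → ℕ) :=
    measurable_pi_lambda _ fun i => Nat.measurable_floor.comp (by fun_prop)
  exact (isCompact_unitCube d).measurableSet.inter (hindex (measurableSet_singleton z))

theorem measurable_cellMonomial (j : ℕ) (z : Fin d → ℕ) (α : Fin d →₀ ℕ) :
    Measurable (cellMonomial j z α) :=
  Measurable.indicator (by fun_prop) (measurableSet_dyadicCell j z)

theorem memLp_cellMonomial [IsFiniteMeasure ν] (q : ℝ≥0∞) (j : ℕ) (z : Fin d → ℕ)
    (α : Fin d →₀ ℕ) : MemLp (cellMonomial j z α) q ν :=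
  MemLp.of_bound (measurable_cellMonomial j z α).aestronglyMeasurable 1 <|
    Filter.Eventually.of_forall fun x => (abs_cellMonomial_le j z α x).trans
      (Set.indicator_le_self' (fun _ _ => zero_le_one) x)

theorem integrable_cellMonomial [IsFiniteMeasure ν] (j : ℕ) (z : Fin d → ℕ) (α : Fin d →₀ ℕ) :
    Integrable (cellMonomial j z α) ν :=
  memLp_one_iff_integrable.1 (memLp_cellMonomial 1 j z α)

theorem sum_measureReal_dyadicCell_le_one [IsProbabilityMeasure ν] (j : ℕ) :
    ∑ z ∈ dyadicIndices d j, ν.real (dyadicCell j z) ≤ 1 := by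
  rw [← measureReal_biUnion_finset _ fun z _ => measurableSet_dyadicCell j z]
  · exact measureReal_le_one
  · exact fun z _ z' _ hz => Set.disjoint_left.2 fun x h h' => hz (h.2.symm.trans h'.2)

theorem integrable_multiscaleApprox [IsFiniteMeasure ν] (J : ℕ) :
    Integrable (multiscaleApprox k p J) ν :=
  integrable_finsetSum _ fun _ _ => integrable_finsetSum _ fun _ _ =>
    integrable_finsetSum _ fun _ _ => (integrable_cellMonomial _ _ _).const_mul _

theorem integral_multiscaleApprox [IsFiniteMeasure ν] (J : ℕ) :
    ∫ x, multiscaleApprox k p J x ∂ν = ∑ j ∈ Finset.range (J + 1), ∑ z ∈ dyadicIndices d j,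
      ∑ α ∈ exponents d k, (cellPolynomial p j z).coeff α * ∫ x, cellMonomial j z α x ∂ν := by
  have hterm (j : ℕ) (z : Fin d → ℕ) (α : Fin d →₀ ℕ) :
      Integrable (fun x => (cellPolynomial p j z).coeff α * cellMonomial j z α x) ν :=
    (integrable_cellMonomial j z α).const_mul _
  simp only [multiscaleApprox]
  rw [integral_finsetSum _ fun j _ => integrable_finsetSum _ fun z _ =>
    integrable_finsetSum _ fun α _ => hterm j z α]
  refine Finset.sum_congr rfl fun j _ => ?_
  rw [integral_finsetSum _ fun z _ => integrable_finsetSum _ fun α _ => hterm j z α]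
  refine Finset.sum_congr rfl fun z _ => ?_
  rw [integral_finsetSum _ fun α _ => hterm j z α]
  exact Finset.sum_congr rfl fun α _ => integral_const_mul _ _

/-- The discrepancy between two measures on the rescaled monomials of all dyadic cells of side at
least `2⁻ᴶ`. The scale `2⁻ʲ` has the weight `2^{-sj}`, which is the size of the coefficients of the
multiscale decomposition of a `C^s` function. -/
noncomputable def dyadicDiscrepancy (k : ℕ) (s : ℝ) (J : ℕ)
    (ν₀ ν₁ : Measure (EuclideanSpace ℝ (Fin d))) : ℝ :=
  ∑ j ∈ Finset.range (J + 1), (2 ^ (-s)) ^ j * ∑ z ∈ dyadicIndices d j, ∑ α ∈ exponents d k,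
    |(∫ x, cellMonomial j z α x ∂ν₀) - ∫ x, cellMonomial j z α x ∂ν₁|

theorem dyadicDiscrepancy_nonneg (J : ℕ) : 0 ≤ dyadicDiscrepancy k s J ν₀ ν₁ :=
  Finset.sum_nonneg fun _ _ => mul_nonneg (by positivity) <| Finset.sum_nonneg fun _ _ =>
    Finset.sum_nonneg fun _ _ => abs_nonneg _

theorem abs_integral_multiscaleApprox_sub_le [IsFiniteMeasure ν₀] [IsFiniteMeasure ν₁]
    (hK : ∀ j, ∀ z ∈ dyadicIndices d j, ∀ α ∈ exponents d k,
      |(cellPolynomial p j z).coeff α| ≤ K * (2 ^ (-s)) ^ j) (J : ℕ) :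
    |(∫ x, multiscaleApprox k p J x ∂ν₀) - ∫ x, multiscaleApprox k p J x ∂ν₁| ≤
      K * dyadicDiscrepancy k s J ν₀ ν₁ := by
  simp only [integral_multiscaleApprox, dyadicDiscrepancy, ← Finset.sum_sub_distrib, ← mul_sub,
    Finset.mul_sum]
  refine (Finset.abs_sum_le_sum_abs _ _).trans (Finset.sum_le_sum fun j _ => ?_)
  refine (Finset.abs_sum_le_sum_abs _ _).trans (Finset.sum_le_sum fun z hz => ?_)
  refine (Finset.abs_sum_le_sum_abs _ _).trans (Finset.sum_le_sum fun α hα => ?_)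
  rw [abs_mul, ← mul_assoc]
  exact mul_le_mul_of_nonneg_right (hK j z hz α hα) (abs_nonneg _)

theorem abs_integral_sub_integral_le_of_ae {E : Type*} [MeasurableSpace E] {μ : Measure E}
    [IsProbabilityMeasure μ] {f h : E → ℝ} {ε : ℝ} (hf : Integrable f μ) (hh : Integrable h μ)
    (hfh : ∀ᵐ x ∂μ, |f x - h x| ≤ ε) : |(∫ x, f x ∂μ) - ∫ x, h x ∂μ| ≤ ε := by
  rw [← integral_sub hf hh]
  simpa using norm_integral_le_of_norm_le_const (f := fun x => f x - h x) hfh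

theorem IsPolynomialApprox.abs_integral_sub_le [IsProbabilityMeasure ν₀] [IsProbabilityMeasure ν₁]
    (h : IsPolynomialApprox k s A g p) (hs : 0 ≤ s) (hg : Continuous g)
    (hK : ∀ j, ∀ z ∈ dyadicIndices d j, ∀ α ∈ exponents d k,
      |(cellPolynomial p j z).coeff α| ≤ K * (2 ^ (-s)) ^ j)
    (h₀ : ∀ᵐ x ∂ν₀, x ∈ unitCube d) (h₁ : ∀ᵐ x ∂ν₁, x ∈ unitCube d) (J : ℕ) :
    |(∫ x, g x ∂ν₀) - ∫ x, g x ∂ν₁| ≤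
      K * dyadicDiscrepancy k s J ν₀ ν₁ + 2 * (A * √d ^ s) * (2 ^ (-s)) ^ J := by
  have happrox (ν : Measure (EuclideanSpace ℝ (Fin d))) [IsProbabilityMeasure ν]
      (hν : ∀ᵐ x ∂ν, x ∈ unitCube d) :
      |(∫ x, g x ∂ν) - ∫ x, multiscaleApprox k p J x ∂ν| ≤ A * √d ^ s * (2 ^ (-s)) ^ J :=
    abs_integral_sub_integral_le_of_ae (integrable_of_continuous_of_ae_mem_unitCube hg hν)
      (integrable_multiscaleApprox J) (hν.mono fun x hx => h.abs_sub_multiscaleApprox_le hs J hx)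
  have hmain := abs_integral_multiscaleApprox_sub_le (ν₀ := ν₀) (ν₁ := ν₁) hK J
  have happrox₀ := happrox ν₀ h₀
  have happrox₁ := happrox ν₁ h₁
  rw [abs_le] at hmain happrox₀ happrox₁ ⊢
  constructor <;> linarith [hmain.1, hmain.2, happrox₀.1, happrox₀.2, happrox₁.1, happrox₁.2]

theorem exists_dualDist_csUnitBall_le (d : ℕ) (hs : 0 < s) : ∃ C : ℝ, 0 ≤ C ∧
    ∀ (ν₀ ν₁ : Measure (EuclideanSpace ℝ (Fin d))) [IsProbabilityMeasure ν₀]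
      [IsProbabilityMeasure ν₁], (∀ᵐ x ∂ν₀, x ∈ unitCube d) → (∀ᵐ x ∂ν₁, x ∈ unitCube d) →
      ∀ J : ℕ, dualDist (csUnitBall d s) ν₀ ν₁ ≤ ENNReal.ofReal
        (C * (dyadicDiscrepancy (holderOrder s) s J ν₀ ν₁ + (2 ^ (-s)) ^ J)) := by
  obtain ⟨K, hK0, hK⟩ := exists_abs_coeff_cellPolynomial_le d (holderOrder s)
  set A : ℝ := d ^ holderOrder s
  set B : ℝ := 2 + (2 * √d) ^ s
  set K' : ℝ := K * (B + A * √d ^ s * (1 + 2 ^ s)) with hK'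
  refine ⟨K' + 2 * (A * √d ^ s), by positivity, fun ν₀ ν₁ _ _ h₀ h₁ J =>
    iSup₂_le fun f hf => ENNReal.ofReal_le_ofReal ?_⟩
  have happrox := (isPolynomialApprox_taylorMvPolynomial hs hf).sub_const (f 0)
  have hbound (x : EuclideanSpace ℝ (Fin d)) (hx : ∀ i, x i ∈ Set.Icc (0 : ℝ) 2) :
      |f x - f 0| ≤ B := by
    have hnorm : ‖x‖ ≤ 2 * √d := norm_le_mul_sqrt_of_abs_le zero_le_two fun i => by
      rw [abs_of_nonneg (hx i).1]
      exact (hx i).2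
    have hgrowth := abs_sub_le_of_mem_csUnitBall hs hf x 0
    rw [sub_zero] at hgrowth
    exact hgrowth.trans (add_le_add le_rfl (Real.rpow_le_rpow (norm_nonneg _) hnorm hs.le))
  have hint (ν : Measure (EuclideanSpace ℝ (Fin d))) [IsProbabilityMeasure ν]
      (hν : ∀ᵐ x ∂ν, x ∈ unitCube d) : ∫ x, (f x - f 0) ∂ν = (∫ x, f x ∂ν) - f 0 := by
    rw [integral_sub (integrable_of_continuous_of_ae_mem_unitCube hf.1.continuous hν)
      (integrable_const _)]
    simp
  have hmain := happrox.abs_integral_sub_le hs.le (by have := hf.1.continuous; fun_prop)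
    (hK happrox hs.le hbound) h₀ h₁ J
  rw [hint ν₀ h₀, hint ν₁ h₁, sub_sub_sub_cancel_right, ← hK'] at hmain
  have hdisc := dyadicDiscrepancy_nonneg (k := holderOrder s) (s := s) (ν₀ := ν₀) (ν₁ := ν₁) J
  have hdisc' : 0 ≤ 2 * (A * √d ^ s) * dyadicDiscrepancy (holderOrder s) s J ν₀ ν₁ := by positivity
  have htail : 0 ≤ K' * (2 ^ (-s)) ^ J := by positivity
  linarith

end DualDistance

/-! ### Empirical measures -/

section EmpiricalMeasure

variable {E Ω : Type*} [MeasurableSpace E] [MeasurableSpace Ω] {μ : Measure E} {P : Measure Ω}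
  {X : ℕ → Ω → E} {φ : E → ℝ} {n : ℕ}

theorem isProbabilityMeasure_empiricalMeasure (x : ℕ → E) (hn : n ≠ 0) :
    IsProbabilityMeasure (empiricalMeasure x n) := by
  constructor
  rw [empiricalMeasure, Measure.smul_apply, Measure.finsetSum_apply]
  simp [ENNReal.inv_mul_cancel (Nat.cast_ne_zero.2 hn) (ENNReal.natCast_ne_top n)]

theorem ae_mem_empiricalMeasure {x : ℕ → E} {S : Set E} (hS : MeasurableSet S)
    (hx : ∀ k, x k ∈ S) : ∀ᵐ y ∂empiricalMeasure x n, y ∈ S := by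
  have hdirac (k : ℕ) : Measure.dirac (x k) Sᶜ = 0 := by
    simp [Measure.dirac_apply' _ hS.compl, hx k]
  change empiricalMeasure x n Sᶜ = 0
  simp [empiricalMeasure, hdirac]

theorem integral_empiricalMeasure (hφ : Measurable φ) (x : ℕ → E) (n : ℕ) :
    ∫ y, φ y ∂empiricalMeasure x n = (n : ℝ)⁻¹ * ∑ k ∈ Finset.Icc 1 n, φ (x k) := by
  rw [empiricalMeasure, integral_smul_measure, integral_finsetSum_measure
    fun k _ => integrable_dirac' hφ.stronglyMeasurable (by simp)]
  simp [integral_dirac' φ _ hφ.stronglyMeasurable]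

/-- The supremum is lower semicontinuous in the sample, so it is measurable although the class of
test functions may be uncountable. -/
theorem measurable_dualDist_empiricalMeasure [TopologicalSpace E] [SecondCountableTopology E]
    [BorelSpace E] {F : Set (E → ℝ)} (hF : ∀ f ∈ F, Continuous f) (μ : Measure E)
    (hX : ∀ k, Measurable (X k)) (n : ℕ) :
    Measurable fun ω => dualDist F (empiricalMeasure (fun k => X k ω) n) μ := by
  have hlsc : LowerSemicontinuous fun x : ℕ → E => dualDist F (empiricalMeasure x n) μ := by
    refine lowerSemicontinuous_biSup fun f hf =>
      (ENNReal.continuous_ofReal.comp ?_).lowerSemicontinuous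
    have hf' := hF f hf
    simp only [integral_empiricalMeasure hf'.measurable]
    fun_prop
  exact hlsc.measurable.comp (measurable_pi_lambda _ hX)

theorem memLp_integral_empiricalMeasure {q : ℝ≥0∞} (hφ : Measurable φ) (hφq : MemLp φ q μ)
    (hX : ∀ k, MeasurePreserving (X k) P μ) (n : ℕ) :
    MemLp (fun ω => ∫ x, φ x ∂empiricalMeasure (fun k => X k ω) n) q P := by
  simp only [integral_empiricalMeasure hφ]
  exact (memLp_finsetSum _ fun k _ => hφq.comp_measurePreserving (hX k)).const_mul _

theorem integral_integral_empiricalMeasure (hφ : Measurable φ) (hφ1 : Integrable φ μ)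
    (hX : ∀ k, MeasurePreserving (X k) P μ) (hn : n ≠ 0) :
    ∫ ω, ∫ x, φ x ∂empiricalMeasure (fun k => X k ω) n ∂P = ∫ x, φ x ∂μ := by
  have hmean (k : ℕ) : ∫ ω, φ (X k ω) ∂P = ∫ x, φ x ∂μ := by
    rw [← (hX k).map_eq, integral_map (hX k).aemeasurable hφ.aestronglyMeasurable]
  have hint (k : ℕ) : Integrable (fun ω => φ (X k ω)) P := (hX k).integrable_comp_of_integrable hφ1
  simp only [integral_empiricalMeasure hφ]
  rw [integral_const_mul, integral_finsetSum _ fun k _ => hint k]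
  simp [hmean, hn]

theorem variance_integral_empiricalMeasure [IsProbabilityMeasure P] (hφ : Measurable φ)
    (hφ2 : MemLp φ 2 μ) (hX : ∀ k, MeasurePreserving (X k) P μ)
    (hind : Pairwise fun i j => IndepFun (X i) (X j) P) (n : ℕ) :
    Var[fun ω => ∫ x, φ x ∂empiricalMeasure (fun k => X k ω) n; P] = Var[φ; μ] / n := by
  have hvar (k : ℕ) : Var[φ ∘ X k; P] = Var[φ; μ] := (hX k).variance_fun_comp hφ.aemeasurable
  have hsum : Var[∑ k ∈ Finset.Icc 1 n, φ ∘ X k; P] = n * Var[φ; μ] := by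
    rw [IndepFun.variance_sum (fun k _ => hφ2.comp_measurePreserving (hX k))
      fun i _ j _ hij => (hind hij).comp hφ hφ]
    simp [hvar]
  have hscale : (fun ω => ∫ x, φ x ∂empiricalMeasure (fun k => X k ω) n) =
      fun ω => (n : ℝ)⁻¹ * (∑ k ∈ Finset.Icc 1 n, φ ∘ X k) ω := by
    simp [integral_empiricalMeasure hφ]
  rw [hscale, variance_const_mul, hsum]
  rcases eq_or_ne (n : ℝ) 0 with hn | hn
  · simp [hn]
  · field_simp

theorem integral_abs_sub_integral_le_sqrt_variance [IsProbabilityMeasure P] {Z : Ω → ℝ}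
    (hZ : MemLp Z 2 P) : ∫ ω, |Z ω - ∫ ω', Z ω' ∂P| ∂P ≤ √Var[Z; P] := by
  have hcentered : MemLp (fun ω => |Z ω - ∫ ω', Z ω' ∂P|) 2 P := (hZ.sub (memLp_const _)).abs
  refine Real.le_sqrt_of_sq_le ?_
  have hnonneg := variance_nonneg (fun ω => |Z ω - ∫ ω', Z ω' ∂P|) P
  rw [variance_eq_sub hcentered, sub_nonneg] at hnonneg
  simpa [variance_eq_integral hZ.aemeasurable] using hnonneg

theorem integrable_abs_integral_empiricalMeasure_sub [IsFiniteMeasure P] (hφ : Measurable φ)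
    (hφ1 : Integrable φ μ) (hX : ∀ k, MeasurePreserving (X k) P μ) (n : ℕ) :
    Integrable (fun ω => |(∫ x, φ x ∂empiricalMeasure (fun k => X k ω) n) - ∫ x, φ x ∂μ|) P := by
  have hint := memLp_integral_empiricalMeasure hφ (memLp_one_iff_integrable.2 hφ1) hX n
  exact ((memLp_one_iff_integrable.1 hint).sub (integrable_const _)).abs

theorem integral_abs_integral_empiricalMeasure_sub_le [IsProbabilityMeasure P]
    [IsProbabilityMeasure μ] (hφ : Measurable φ) (hφ2 : MemLp φ 2 μ)
    (hX : ∀ k, MeasurePreserving (X k) P μ) (hind : Pairwise fun i j => IndepFun (X i) (X j) P)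
    (hn : n ≠ 0) :
    ∫ ω, |(∫ x, φ x ∂empiricalMeasure (fun k => X k ω) n) - ∫ x, φ x ∂μ| ∂P ≤
      √(∫ x, φ x ^ 2 ∂μ) / √n := by
  have hdev := integral_abs_sub_integral_le_sqrt_variance
    (memLp_integral_empiricalMeasure hφ hφ2 hX n)
  rw [integral_integral_empiricalMeasure hφ (hφ2.integrable one_le_two) hX hn,
    variance_integral_empiricalMeasure hφ hφ2 hX hind, Real.sqrt_div (variance_nonneg _ _)] at hdev
  refine hdev.trans ?_
  gcongr
  exact variance_le_expectation_sq hφ.aestronglyMeasurable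

end EmpiricalMeasure

section EmpiricalDiscrepancy

variable {d k : ℕ} {s : ℝ} {Ω : Type*} [MeasurableSpace Ω] {P : Measure Ω}
  {μ : Measure (EuclideanSpace ℝ (Fin d))} {X : ℕ → Ω → EuclideanSpace ℝ (Fin d)} {n : ℕ}

theorem integral_cellMonomial_sq_le [IsFiniteMeasure μ] (j : ℕ) (z : Fin d → ℕ) (α : Fin d →₀ ℕ) :
    ∫ x, cellMonomial j z α x ^ 2 ∂μ ≤ μ.real (dyadicCell j z) := by
  rw [← integral_indicator_one (measurableSet_dyadicCell j z)]
  refine integral_mono (memLp_cellMonomial 2 j z α).integrable_sq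
    ((integrable_const 1).indicator (measurableSet_dyadicCell j z)) fun x => ?_
  have hle := abs_cellMonomial_le j z α x
  have hle_one : |cellMonomial j z α x| ≤ 1 :=
    hle.trans (Set.indicator_le_self' (fun _ _ => zero_le_one) x)
  calc cellMonomial j z α x ^ 2 = |cellMonomial j z α x| * |cellMonomial j z α x| := by
        rw [← sq_abs, sq]
    _ ≤ |cellMonomial j z α x| := mul_le_of_le_one_left (abs_nonneg _) hle_one
    _ ≤ (dyadicCell j z).indicator 1 x := hle

theorem integral_abs_integral_cellMonomial_sub_le [IsProbabilityMeasure P] [IsProbabilityMeasure μ]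
    (hX : ∀ k, MeasurePreserving (X k) P μ) (hind : Pairwise fun i j => IndepFun (X i) (X j) P)
    (hn : n ≠ 0) (j : ℕ) (z : Fin d → ℕ) (α : Fin d →₀ ℕ) :
    ∫ ω, |(∫ x, cellMonomial j z α x ∂empiricalMeasure (fun i => X i ω) n) -
      ∫ x, cellMonomial j z α x ∂μ| ∂P ≤ √(μ.real (dyadicCell j z)) / √n := by
  refine (integral_abs_integral_empiricalMeasure_sub_le (measurable_cellMonomial j z α)
    (memLp_cellMonomial 2 j z α) hX hind hn).trans ?_
  gcongr
  exact integral_cellMonomial_sq_le j z α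

theorem sum_sqrt_measureReal_dyadicCell_le [IsProbabilityMeasure μ] (j : ℕ) :
    ∑ z ∈ dyadicIndices d j, √(μ.real (dyadicCell j z)) ≤ √((2 ^ j + 1) ^ d) := by
  refine Real.le_sqrt_of_sq_le (sq_sum_le_card_mul_sum_sq.trans ?_)
  rw [card_dyadicIndices]
  simp only [Real.sq_sqrt measureReal_nonneg]
  push_cast
  exact mul_le_of_le_one_right (by positivity) (sum_measureReal_dyadicCell_le_one j)

theorem sqrt_two_pow_add_one_pow_le (d j : ℕ) :
    √((2 ^ j + 1) ^ d) ≤ 2 ^ ((d : ℝ) / 2) * (2 ^ ((d : ℝ) / 2)) ^ j := by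
  have hbase : (2 : ℝ) ^ j + 1 ≤ 2 ^ (j + 1) := by
    rw [pow_succ, mul_two]
    gcongr
    exact one_le_pow₀ one_le_two
  have hsqrt : (2 : ℝ) ^ ((d : ℝ) / 2) = √(2 ^ d) := by
    rw [Real.sqrt_eq_rpow, ← Real.rpow_natCast_mul zero_le_two, mul_one_div]
  rw [← pow_succ', hsqrt]
  refine Real.sqrt_le_iff.2 ⟨by positivity, ?_⟩
  calc ((2 : ℝ) ^ j + 1) ^ d ≤ (2 ^ (j + 1)) ^ d := by gcongr
    _ = (√(2 ^ d) ^ (j + 1)) ^ 2 := by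
        rw [pow_right_comm √_, Real.sq_sqrt (by positivity), pow_right_comm]

theorem integrable_dyadicDiscrepancy [IsFiniteMeasure P] [IsFiniteMeasure μ]
    (hX : ∀ k, MeasurePreserving (X k) P μ) (J : ℕ) :
    Integrable (fun ω => dyadicDiscrepancy k s J (empiricalMeasure (fun i => X i ω) n) μ) P :=
  integrable_finsetSum _ fun j _ => (integrable_finsetSum _ fun z _ => integrable_finsetSum _
    fun α _ => integrable_abs_integral_empiricalMeasure_sub (measurable_cellMonomial j z α)
      (integrable_cellMonomial j z α) hX n).const_mul _

theorem integral_dyadicDiscrepancy_le [IsProbabilityMeasure P] [IsProbabilityMeasure μ]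
    (hX : ∀ k, MeasurePreserving (X k) P μ) (hind : Pairwise fun i j => IndepFun (X i) (X j) P)
    (hn : n ≠ 0) (J : ℕ) :
    ∫ ω, dyadicDiscrepancy k s J (empiricalMeasure (fun i => X i ω) n) μ ∂P ≤
      (exponents d k).card * 2 ^ ((d : ℝ) / 2) *
        ((∑ j ∈ Finset.range (J + 1), (2 ^ ((d : ℝ) / 2 - s)) ^ j) / √n) := by
  have hint (j : ℕ) (z : Fin d → ℕ) (α : Fin d →₀ ℕ) := integrable_abs_integral_empiricalMeasure_sub
    (measurable_cellMonomial j z α) (integrable_cellMonomial j z α) hX n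
  have hscale (j : ℕ) : ∑ z ∈ dyadicIndices d j, ∑ _α ∈ exponents d k,
      √(μ.real (dyadicCell j z)) / √n ≤
        (exponents d k).card * (2 ^ ((d : ℝ) / 2) * (2 ^ ((d : ℝ) / 2)) ^ j) / √n := by
    simp only [Finset.sum_const, nsmul_eq_mul, ← Finset.mul_sum, ← Finset.sum_div]
    rw [← mul_div_assoc]
    gcongr
    exact (sum_sqrt_measureReal_dyadicCell_le j).trans (sqrt_two_pow_add_one_pow_le d j)
  simp only [dyadicDiscrepancy]
  rw [integral_finsetSum _ fun j _ => (integrable_finsetSum _ fun z _ =>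
    integrable_finsetSum _ fun α _ => hint j z α).const_mul _, Finset.sum_div, Finset.mul_sum]
  refine Finset.sum_le_sum fun j _ => ?_
  rw [integral_const_mul, integral_finsetSum _ fun z _ =>
    integrable_finsetSum _ fun α _ => hint j z α]
  simp only [integral_finsetSum _ fun α _ => hint j _ α]
  calc _ ≤ ((2 : ℝ) ^ (-s)) ^ j *
        ((exponents d k).card * (2 ^ ((d : ℝ) / 2) * (2 ^ ((d : ℝ) / 2)) ^ j) / √n) := by
        gcongr
        exact (Finset.sum_le_sum fun z _ => Finset.sum_le_sum fun α _ =>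
          integral_abs_integral_cellMonomial_sub_le hX hind hn j z α).trans (hscale j)
    _ = _ := by
        rw [sub_eq_add_neg, Real.rpow_add zero_lt_two, mul_pow]
        ring

theorem exists_lintegral_dualDist_le (d : ℕ) (hs : 0 < s) : ∃ C : ℝ, 0 ≤ C ∧
    ∀ (μ : Measure (EuclideanSpace ℝ (Fin d))) [IsProbabilityMeasure μ],
      (∀ᵐ x ∂μ, x ∈ unitCube d) →
    ∀ {Ω : Type*} [MeasurableSpace Ω] (P : Measure Ω) [IsProbabilityMeasure P]
      (X : ℕ → Ω → EuclideanSpace ℝ (Fin d)), (∀ k, MeasurePreserving (X k) P μ) →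
      (Pairwise fun i j => IndepFun (X i) (X j) P) → ∀ n : ℕ, n ≠ 0 → ∀ J : ℕ,
      ∫⁻ ω, dualDist (csUnitBall d s) (empiricalMeasure (fun k => X k ω) n) μ ∂P ≤
        ENNReal.ofReal (C * ((∑ j ∈ Finset.range (J + 1), (2 ^ ((d : ℝ) / 2 - s)) ^ j) / √n +
          (2 ^ (-s)) ^ J)) := by
  obtain ⟨C, hC0, hC⟩ := exists_dualDist_csUnitBall_le d hs
  set M : ℝ := (exponents d (holderOrder s)).card * 2 ^ ((d : ℝ) / 2)
  refine ⟨C * (M + 1), by positivity, fun μ _ hμ Ω _ P _ X hX hind n hn J => ?_⟩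
  have hXcube : ∀ᵐ ω ∂P, ∀ k, X k ω ∈ unitCube d :=
    ae_all_iff.2 fun k => (hX k).quasiMeasurePreserving.ae hμ
  have hint : Integrable (fun ω => dyadicDiscrepancy (holderOrder s) s J
      (empiricalMeasure (fun k => X k ω) n) μ) P := integrable_dyadicDiscrepancy hX J
  have hsum : 0 ≤ (∑ j ∈ Finset.range (J + 1), ((2 : ℝ) ^ ((d : ℝ) / 2 - s)) ^ j) / √n := by
    positivity
  have htail : 0 ≤ M * ((2 : ℝ) ^ (-s)) ^ J := by positivity
  calc _ ≤ ∫⁻ ω, ENNReal.ofReal (C * (dyadicDiscrepancy (holderOrder s) s J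
        (empiricalMeasure (fun k => X k ω) n) μ + (2 ^ (-s)) ^ J)) ∂P := by
        refine lintegral_mono_ae (hXcube.mono fun ω hω => ?_)
        have := isProbabilityMeasure_empiricalMeasure (fun k => X k ω) hn
        exact hC _ μ (ae_mem_empiricalMeasure (isCompact_unitCube d).measurableSet hω) hμ J
    _ = ENNReal.ofReal (C * (∫ ω, dyadicDiscrepancy (holderOrder s) s J
        (empiricalMeasure (fun k => X k ω) n) μ ∂P + (2 ^ (-s)) ^ J)) := by
        have hint' := (hint.add (integrable_const ((2 ^ (-s)) ^ J))).const_mul C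
        simp only [Pi.add_apply] at hint'
        rw [← ofReal_integral_eq_lintegral_ofReal hint'
          (Filter.Eventually.of_forall fun ω => mul_nonneg hC0
            (add_nonneg (dyadicDiscrepancy_nonneg J) (by positivity))),
          integral_const_mul, integral_add hint (integrable_const _)]
        simp
    _ ≤ _ := by
        rw [mul_assoc]
        gcongr
        linarith [integral_dyadicDiscrepancy_le (k := holderOrder s) (s := s) hX hind hn J]

end EmpiricalDiscrepancy

/-! ### The number of scales -/

section Rate

variable {d n : ℕ} {s : ℝ}

theorem geom_sum_le_of_one_lt {K : Type*} [Field K] [LinearOrder K] [IsStrictOrderedRing K] {r : K}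
    (hr : 1 < r) (J : ℕ) : ∑ j ∈ Finset.range (J + 1), r ^ j ≤ r / (r - 1) * r ^ J := by
  have hr' := sub_pos.2 hr
  rw [geom_sum_eq hr.ne', div_mul_eq_mul_div, ← pow_succ']
  gcongr
  exact sub_le_self _ zero_le_one

theorem exists_two_pow_le_rpow_inv_lt (d : ℕ) (hn : n ≠ 0) :
    ∃ J : ℕ, (2 : ℝ) ^ J ≤ (n : ℝ) ^ (d : ℝ)⁻¹ ∧ (n : ℝ) ^ (d : ℝ)⁻¹ < 2 ^ (J + 1) :=
  exists_nat_pow_near (Real.one_le_rpow (Nat.one_le_cast.2 (Nat.one_le_iff_ne_zero.2 hn))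
    (by positivity)) one_lt_two

theorem two_rpow_neg_pow_le (hs : 0 ≤ s) (hn : n ≠ 0) {J : ℕ}
    (hJ : (n : ℝ) ^ (d : ℝ)⁻¹ < 2 ^ (J + 1)) :
    ((2 : ℝ) ^ (-s)) ^ J ≤ 2 ^ s * (1 / (n : ℝ) ^ (s / d)) := by
  have hn0 : (0 : ℝ) < n := Nat.cast_pos.2 (Nat.pos_of_ne_zero hn)
  have hpow : (n : ℝ) ^ (s / d) ≤ 2 ^ s * (2 ^ s) ^ J := by
    calc (n : ℝ) ^ (s / d) = ((n : ℝ) ^ (d : ℝ)⁻¹) ^ s := by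
          rw [← Real.rpow_mul hn0.le, inv_mul_eq_div]
      _ ≤ (2 ^ (J + 1)) ^ s := Real.rpow_le_rpow (by positivity) hJ.le hs
      _ = 2 ^ s * (2 ^ s) ^ J := by
          rw [← Real.rpow_pow_comm zero_le_two, pow_succ']
  rw [Real.rpow_neg zero_le_two, inv_pow, mul_one_div, le_div_iff₀ (by positivity),
    inv_mul_le_iff₀ (by positivity), mul_comm]
  exact hpow

theorem exists_scale_le_inv_sqrt (hs : 0 < s) (hds : (d : ℝ) / 2 < s) : ∃ C : ℝ, 0 < C ∧
    ∀ n : ℕ, n ≠ 0 → ∃ J : ℕ,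
      (∑ j ∈ Finset.range (J + 1), ((2 : ℝ) ^ ((d : ℝ) / 2 - s)) ^ j) / √n + (2 ^ (-s)) ^ J ≤
        C * (1 / √n) := by
  set r : ℝ := 2 ^ ((d : ℝ) / 2 - s)
  have hr0 : 0 < r := by positivity
  have hr1 : r < 1 := Real.rpow_lt_one_of_one_lt_of_neg one_lt_two (sub_neg.2 hds)
  have hr1' := sub_pos.2 hr1
  refine ⟨(1 - r)⁻¹ + 1, by positivity, fun n hn => ?_⟩
  have hn0 : (0 : ℝ) < n := Nat.cast_pos.2 (Nat.pos_of_ne_zero hn)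
  obtain ⟨J, hJ⟩ := exists_pow_lt_of_lt_one (by positivity : 0 < 1 / √(n : ℝ))
    (Real.rpow_lt_one_of_one_lt_of_neg one_lt_two (neg_lt_zero.2 hs))
  have hsum : ∑ j ∈ Finset.range (J + 1), r ^ j ≤ (1 - r)⁻¹ := by
    rw [← tsum_geometric_of_lt_one hr0.le hr1]
    exact (summable_geometric_of_lt_one hr0.le hr1).sum_le_tsum _ fun _ _ => by positivity
  refine ⟨J, ?_⟩
  rw [add_mul, one_mul, mul_one_div]
  gcongr

theorem exists_scale_le_log_div_sqrt (hs : 0 < s) (hds : s = (d : ℝ) / 2) : ∃ C : ℝ, 0 < C ∧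
    ∀ n : ℕ, 2 ≤ n → ∃ J : ℕ,
      (∑ j ∈ Finset.range (J + 1), ((2 : ℝ) ^ ((d : ℝ) / 2 - s)) ^ j) / √n + (2 ^ (-s)) ^ J ≤
        C * (Real.log n / √n) := by
  have hd0 : (0 : ℝ) < d := by linarith
  have hlog2 : 0 < Real.log 2 := Real.log_pos one_lt_two
  refine ⟨2 / Real.log 2 + 2 ^ s / Real.log 2, by positivity, fun n hn => ?_⟩
  have hn2 : (2 : ℝ) ≤ n := Nat.ofNat_le_cast.2 hn
  have hn0 : n ≠ 0 := by lia
  have hlog : Real.log 2 ≤ Real.log n := Real.log_le_log zero_lt_two hn2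
  obtain ⟨J, hJ, hJ'⟩ := exists_two_pow_le_rpow_inv_lt d hn0
  have hscales : (J + 1 : ℝ) ≤ 2 / Real.log 2 * Real.log n := by
    have hroot : (n : ℝ) ^ (d : ℝ)⁻¹ ≤ n :=
      Real.rpow_le_self_of_one_le (by linarith) (Nat.cast_inv_le_one d)
    have hlogJ := Real.log_le_log (by positivity) (hJ.trans hroot)
    rw [Real.log_pow] at hlogJ
    rw [div_mul_eq_mul_div, le_div_iff₀ hlog2]
    linarith
  have htail : ((2 : ℝ) ^ (-s)) ^ J ≤ 2 ^ s / Real.log 2 * (Real.log n / √n) := by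
    have hexp : s / d = 1 / 2 := by
      rw [hds]
      field_simp
    refine (two_rpow_neg_pow_le hs.le hn0 hJ').trans ?_
    rw [hexp, ← Real.sqrt_eq_rpow, div_mul_div_comm, mul_one_div, mul_comm (Real.log 2),
      mul_div_mul_comm]
    exact le_mul_of_one_le_right (by positivity) ((one_le_div hlog2).2 hlog)
  refine ⟨J, ?_⟩
  rw [← hds, sub_self, add_mul, ← mul_div_assoc]
  refine add_le_add ?_ htail
  gcongr
  simpa using hscales

theorem exists_scale_le_inv_rpow (hs : 0 < s) (hds : s < (d : ℝ) / 2) : ∃ C : ℝ, 0 < C ∧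
    ∀ n : ℕ, n ≠ 0 → ∃ J : ℕ,
      (∑ j ∈ Finset.range (J + 1), ((2 : ℝ) ^ ((d : ℝ) / 2 - s)) ^ j) / √n + (2 ^ (-s)) ^ J ≤
        C * (1 / (n : ℝ) ^ (s / d)) := by
  have hd0 : (0 : ℝ) < d := by linarith
  set r : ℝ := 2 ^ ((d : ℝ) / 2 - s)
  have hr1 : 1 < r := Real.one_lt_rpow one_lt_two (sub_pos.2 hds)
  have hr1' := sub_pos.2 hr1
  refine ⟨r / (r - 1) + 2 ^ s, by positivity, fun n hn => ?_⟩
  have hn0 : (0 : ℝ) < n := Nat.cast_pos.2 (Nat.pos_of_ne_zero hn)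
  obtain ⟨J, hJ, hJ'⟩ := exists_two_pow_le_rpow_inv_lt d hn
  have hlast : r ^ J ≤ √n * (1 / (n : ℝ) ^ (s / d)) := by
    calc r ^ J = (2 ^ J) ^ ((d : ℝ) / 2 - s) := Real.rpow_pow_comm zero_le_two _ _
      _ ≤ ((n : ℝ) ^ (d : ℝ)⁻¹) ^ ((d : ℝ) / 2 - s) :=
          Real.rpow_le_rpow (by positivity) hJ (sub_nonneg.2 hds.le)
      _ = (n : ℝ) ^ (1 / 2 - s / d) := by
          rw [← Real.rpow_mul hn0.le]
          congr 1
          field_simp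
      _ = √n * (1 / (n : ℝ) ^ (s / d)) := by
          rw [Real.rpow_sub hn0, Real.sqrt_eq_rpow, mul_one_div]
  refine ⟨J, ?_⟩
  rw [add_mul]
  refine add_le_add ?_ (two_rpow_neg_pow_le hs.le hn hJ')
  rw [div_le_iff₀ (Real.sqrt_pos.2 hn0), mul_assoc, mul_comm _ √_]
  refine (geom_sum_le_of_one_lt hr1 J).trans ?_
  gcongr

theorem exists_scale_le_rate (d : ℕ) (hs : 0 < s) : ∃ C : ℝ, 0 < C ∧
    ∀ n : ℕ, 2 ≤ n → ∃ J : ℕ,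
      (∑ j ∈ Finset.range (J + 1), ((2 : ℝ) ^ ((d : ℝ) / 2 - s)) ^ j) / √n + (2 ^ (-s)) ^ J ≤
        C * rate d s n := by
  unfold rate
  split_ifs with hlt heq
  · exact (exists_scale_le_inv_sqrt hs hlt).imp fun C hC => hC.imp_right
      fun h n hn => h n (by lia)
  · exact exists_scale_le_log_div_sqrt hs heq
  · exact (exists_scale_le_inv_rpow hs (lt_of_le_of_ne (not_lt.1 hlt) heq)).imp fun C hC =>
      hC.imp_right fun h n hn => h n (by lia)

end Rate

theorem theoremC_general (d : ℕ) (s : ℝ) (hs : 0 < s) :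
    ∃ C : ℝ, 0 < C ∧
      ∀ (μ : Measure (EuclideanSpace ℝ (Fin d))) [IsProbabilityMeasure μ],
        μ (unitCube d) = 1 →
      ∀ {Ω : Type*} [MeasurableSpace Ω] (P : Measure Ω) [IsProbabilityMeasure P]
        (X : ℕ → Ω → EuclideanSpace ℝ (Fin d)),
        (∀ k, Measurable (X k)) → (Pairwise fun i j => IndepFun (X i) (X j) P) →
        (∀ k, P.map (X k) = μ) →
      ∀ n : ℕ, 2 ≤ n →
        Measurable (fun ω => dualDist (csUnitBall d s) (empiricalMeasure (fun k => X k ω) n) μ) ∧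
        ∫⁻ ω, dualDist (csUnitBall d s) (empiricalMeasure (fun k => X k ω) n) μ ∂P
          ≤ ENNReal.ofReal (C * rate d s n) := by
  obtain ⟨C₁, hC₁, hexpect⟩ := exists_lintegral_dualDist_le d hs
  obtain ⟨C₂, hC₂, hrate⟩ := exists_scale_le_rate d hs
  refine ⟨(C₁ + 1) * C₂, by positivity, fun μ _ hμ Ω _ P _ X hX hind hlaw n hn =>
    ⟨measurable_dualDist_empiricalMeasure (fun f hf => hf.1.continuous) μ hX n, ?_⟩⟩
  obtain ⟨J, hJ⟩ := hrate n hn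
  have hμcube : ∀ᵐ x ∂μ, x ∈ unitCube d :=
    (prob_compl_eq_zero_iff (isCompact_unitCube d).measurableSet).2 hμ
  refine (hexpect μ hμcube P X (fun k => ⟨hX k, hlaw k⟩) hind n (by lia) J).trans
    (ENNReal.ofReal_le_ofReal ?_)
  rw [mul_assoc]
  exact mul_le_mul (le_add_of_nonneg_right zero_le_one) hJ (by positivity) (by positivity)

theorem theoremC (d : ℕ) (s : ℝ) (hs : 1 ≤ s) :
    ∃ C : ℝ, 0 < C ∧
      ∀ (μ : Measure (EuclideanSpace ℝ (Fin d))) [IsProbabilityMeasure μ],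
        μ (unitCube d) = 1 →
      ∀ {Ω : Type*} [MeasurableSpace Ω] (P : Measure Ω) [IsProbabilityMeasure P]
        (X : ℕ → Ω → EuclideanSpace ℝ (Fin d)),
        (∀ k, Measurable (X k)) → iIndepFun X P → (∀ k, P.map (X k) = μ) →
      ∀ n : ℕ, 2 ≤ n →
        Measurable (fun ω => dualDist (csUnitBall d s) (empiricalMeasure (fun k => X k ω) n) μ) ∧
        ∫⁻ ω, dualDist (csUnitBall d s) (empiricalMeasure (fun k => X k ω) n) μ ∂P
          ≤ ENNReal.ofReal (C * rate d s n) := by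
  obtain ⟨C, hC, h⟩ := theoremC_general d s (zero_lt_one.trans_le hs)
  exact ⟨C, hC, fun μ _ hμ _ _ P _ X hX hind => h μ hμ P X hX fun _ _ hij => hind.indepFun hij⟩
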